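/- Let $\{W(s,t) : s,t\ge 0\}$ be a standard Wiener field, i.e. a zero-mean Gauss field with almost surely continuous sample paths and covariance $\operatorname{cov}(W(s_1,t_1),W(s_2,t_2))=\min(s_1,s_2)\min(t_1,t_2)$, and put $$X(s,t):=e^{-(s+t)/2}\,W(e^{s},e^{t}),\qquad s,t\in\mathbb R .$$ Then $X$ is a stationary Ornstein–Uhlenbeck field with parameters $(\tfrac12,\tfrac12,1)$, i.e. a zero-mean Gauss field with almost surely continuous sample paths and covariance $\operatorname{cov}(X(s_1,t_1),X(s_2,t_2))=\exp\{-\tfrac12|s_2-s_1|-\tfrac12|t_2-t_1|\}$. Define, for $(s,t)\in[0,1]^2$, $$U(s,t):=\begin{cases}\sqrt{st(1-s)(1-t)}\;X\!\left(\ln\frac{s}{1-s},\,\ln\frac{t}{1-t}\right) & \text{if } (s,t)\in(0,1)^2,\\ 0 & \text{if } s\in\{0,1\}\text{ or }t\in\{0,1\}.\end{cases}$$ Let $W'$ be a standard Wiener field, possibly on another probability space and possibly equal to $W$, and let $$B_*(s,t):=W'(s,t)-sW'(1,t)-tW'(s,1)+st\,W'(1,1),\qquad (s,t)\in[0,1]^2,$$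 be the corresponding tied-down Wiener bridge. Then $U$ and $B_*$ have almost surely continuous sample paths on $[0,1]^2$, and they generate the same law on $C([0,1]^2)$ (with the uniform topology and its Borel $\sigma$-algebra). -/

import Mathlib

open MeasureTheory ProbabilityTheory
open scoped NNReal unitInterval

noncomputable section

/-- A standard Wiener field on `ℝ₊²`: a zero-mean Gauss field with almost surely continuous
sample paths and covariance `(s₁ ∧ s₂) (t₁ ∧ t₂)`. -/
structure IsWienerField {Ω : Type*} [MeasurableSpace Ω] (W : ℝ≥0 × ℝ≥0 → Ω → ℝ)
    (P : Measure Ω) : Prop where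
  isGaussianProcess : IsGaussianProcess W P
  mean_eq_zero : ∀ p, ∫ ω, W p ω ∂P = 0
  covariance_eq : ∀ p q, cov[W p, W q; P] = (min p.1 q.1 : ℝ) * (min p.2 q.2 : ℝ)
  ae_continuous : ∀ᵐ ω ∂P, Continuous fun p ↦ W p ω

/-- A stationary Ornstein–Uhlenbeck field on `ℝ²` with parameters `(α, β, sig)`
(meant for `α, β, sig > 0`). -/
structure IsStationaryOUField {Ω : Type*} [MeasurableSpace Ω] (α β sig : ℝ)
    (X : ℝ × ℝ → Ω → ℝ) (P : Measure Ω) : Prop where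
  isGaussianProcess : IsGaussianProcess X P
  mean_eq_zero : ∀ p, ∫ ω, X p ω ∂P = 0
  covariance_eq : ∀ p q, cov[X p, X q; P] =
    sig ^ 2 / (4 * α * β) * Real.exp (-α * |q.1 - p.1| - β * |q.2 - p.2|)
  ae_continuous : ∀ᵐ ω ∂P, Continuous fun p ↦ X p ω

/-- The field `(s, t) ↦ sig / (2 √(α β)) e^{-α s - β t} W(e^{2 α s}, e^{2 β t})` on `ℝ²`. -/
def ouFieldOfWiener {Ω : Type*} (α β sig : ℝ) (W : ℝ≥0 × ℝ≥0 → Ω → ℝ) : ℝ × ℝ → Ω → ℝ :=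
  fun p ω ↦ sig / (2 * Real.sqrt (α * β)) * Real.exp (-α * p.1 - β * p.2) *
    W (⟨Real.exp (2 * α * p.1), (Real.exp_pos _).le⟩,
      ⟨Real.exp (2 * β * p.2), (Real.exp_pos _).le⟩) ω

open Classical in
/-- The space-domain scaling of a field `X` on `ℝ²` to the closed unit square, set to be zero
on the boundary of the square. -/
def scaledField {Ω : Type*} (X : ℝ × ℝ → Ω → ℝ) : I × I → Ω → ℝ :=
  fun p ω ↦
    let s : ℝ := p.1
    let t : ℝ := p.2
    if s ∈ Set.Ioo (0 : ℝ) 1 ∧ t ∈ Set.Ioo (0 : ℝ) 1 then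
      Real.sqrt (s * t * (1 - s) * (1 - t)) *
        X (Real.log (s / (1 - s)), Real.log (t / (1 - t))) ω
    else 0

/-- The tied-down Wiener bridge `W(s,t) - s W(1,t) - t W(s,1) + s t W(1,1)` on the closed
unit square. -/
def tiedDownBridge {Ω : Type*} (W : ℝ≥0 × ℝ≥0 → Ω → ℝ) : I × I → Ω → ℝ :=
  fun p ω ↦
    let s : ℝ≥0 := unitInterval.toNNReal p.1
    let t : ℝ≥0 := unitInterval.toNNReal p.2
    W (s, t) ω - (s : ℝ) * W (1, t) ω - (t : ℝ) * W (s, 1) ω + (s : ℝ) * (t : ℝ) * W (1, 1) ω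

/-- The space `C([0,1]²)`, with the topology of uniform convergence, carries its Borel
σ-algebra. -/
instance instMeasurableSpaceContinuousMapSquare : MeasurableSpace C(I × I, ℝ) := borel _

instance instBorelSpaceContinuousMapSquare : BorelSpace C(I × I, ℝ) := ⟨rfl⟩

open Classical in
/-- The sample path of a field on the unit square, as an element of `C([0,1]²)`; the zero
function is taken where the sample path is not continuous (for a field with almost surely
continuous sample paths, this happens on a null set only). -/
def samplePath {Ω : Type*} (Y : I × I → Ω → ℝ) (ω : Ω) : C(I × I, ℝ) :=
  if h : Continuous fun p ↦ Y p ω then ⟨fun p ↦ Y p ω, h⟩ else 0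

end

/-! In the open square, `U(s,t) = (1-s)(1-t) W(s/(1-s), t/(1-t))`. So `U` and `B_*` are centred
Gaussian with the same covariance `(s∧s' - ss')(t∧t' - tt')`, and hence have the same law on every
countable set of points.

The hard point is the continuity of `U` at the boundary, where the argument of `X` runs off to
infinity. It is borrowed from `B_*`: uniform continuity on a countable dense grid is a measurable
event (`measurableSet_setOf_uniformContinuous`), almost sure for `B_*` by compactness, hence almost
sure for `U`; `continuous_of_uniformContinuous_grid` then gives continuity on the whole square.
Continuous paths are determined by their values on the grid, so the laws on `C([0,1]²)` agree
(`identDistrib_samplePath`). -/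

section GaussianLaw

variable {Ω Ω' T : Type*} [MeasurableSpace Ω] [MeasurableSpace Ω'] {P : Measure Ω}
  {P' : Measure Ω'} {X : T → Ω → ℝ} {Y : T → Ω' → ℝ}

/-- A centred Gaussian vector is determined in law by its covariance matrix. -/
lemma ProbabilityTheory.HasGaussianLaw.map_eq_of_covariance_eq {ι : Type*} [Fintype ι]
    {X : ι → Ω → ℝ} {Y : ι → Ω' → ℝ}
    (hX : HasGaussianLaw (fun ω i ↦ X i ω) P) (hY : HasGaussianLaw (fun ω i ↦ Y i ω) P')
    (mX : ∀ i, ∫ ω, X i ω ∂P = 0) (mY : ∀ i, ∫ ω, Y i ω ∂P' = 0)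
    (h : ∀ i j, cov[X i, X j; P] = cov[Y i, Y j; P']) :
    P.map (fun ω i ↦ X i ω) = P'.map (fun ω i ↦ Y i ω) := by
  classical
  have := hX.isProbabilityMeasure
  have := hY.isProbabilityMeasure
  have hXi (i : ι) : HasGaussianLaw (X i) P := hX.map_fun (.proj (R := ℝ) (φ := fun _ : ι ↦ ℝ) i)
  have hYi (i : ι) : HasGaussianLaw (Y i) P' := hY.map_fun (.proj (R := ℝ) (φ := fun _ : ι ↦ ℝ) i)
  have := Measure.isProbabilityMeasure_map (μ := P) hX.aemeasurable
  have := Measure.isProbabilityMeasure_map (μ := P') hY.aemeasurable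
  refine Measure.ext_of_charFunDual (funext fun L ↦ ?_)
  -- The characteristic function at `L` depends only on the mean and variance of `L`; in coordinates
  -- these reduce to means and covariances.
  obtain ⟨c, hL⟩ : ∃ c : ι → ℝ, ∀ x, L x = ∑ i, c i * x i := by
    refine ⟨fun i ↦ L (Pi.single i 1), fun x ↦ ?_⟩
    conv_lhs => rw [← Finset.univ_sum_single x, map_sum]
    refine Finset.sum_congr rfl fun i _ ↦ ?_
    rw [mul_comm, ← smul_eq_mul, ← map_smul, ← Pi.single_smul]
    simp
  rw [hX.charFunDual_map_eq_fun, hY.charFunDual_map_eq_fun]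
  simp_rw [hL]
  rw [variance_fun_sum' fun i _ ↦ (hXi i).memLp_two.const_mul _,
    variance_fun_sum' fun i _ ↦ (hYi i).memLp_two.const_mul _,
    integral_finsetSum _ fun i _ ↦ (hXi i).integrable.const_mul _,
    integral_finsetSum _ fun i _ ↦ (hYi i).integrable.const_mul _]
  simp_rw [covariance_const_mul_left, covariance_const_mul_right, integral_const_mul, mX, mY, h]

/-- Centred Gaussian processes with a countable index set and the same covariance function have
the same law. -/
lemma ProbabilityTheory.IsGaussianProcess.map_eq_of_covariance_eq [Countable T]
    (hX : IsGaussianProcess X P) (hY : IsGaussianProcess Y P')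
    (mX : ∀ t, ∫ ω, X t ω ∂P = 0) (mY : ∀ t, ∫ ω, Y t ω ∂P' = 0)
    (h : ∀ s t, cov[X s, X t; P] = cov[Y s, Y t; P']) :
    P.map (fun ω t ↦ X t ω) = P'.map (fun ω t ↦ Y t ω) := by
  have := hX.isProbabilityMeasure
  have := hY.isProbabilityMeasure
  have lX := isProjectiveLimit_map (aemeasurable_pi_lambda _ hX.aemeasurable)
  have lY := isProjectiveLimit_map (aemeasurable_pi_lambda _ hY.aemeasurable)
  have heq (J : Finset T) : P.map (fun ω ↦ J.restrict (X · ω)) =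
      P'.map (fun ω ↦ J.restrict (Y · ω)) :=
    HasGaussianLaw.map_eq_of_covariance_eq (X := fun j : J ↦ X j) (Y := fun j : J ↦ Y j)
      (hX.hasGaussianLaw J) (hY.hasGaussianLaw J) (fun _ ↦ mX _) (fun _ ↦ mY _) fun _ _ ↦ h _ _
  simp_rw [heq] at lX
  exact lX.unique lY

end GaussianLaw

/-! ### Continuous paths and their restrictions to a countable dense set -/

section PathSpace

/-- Uniform continuity is a measurable condition on functions on a countable space. -/
lemma measurableSet_setOf_uniformContinuous (D : Type*) [PseudoMetricSpace D] [Countable D] :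
    MeasurableSet {f : D → ℝ | UniformContinuous f} := by
  -- Taking `ε` and `δ` of the form `1/(k+1)` makes all quantifiers countable.
  have h : {f : D → ℝ | UniformContinuous f} = ⋂ n : ℕ, ⋃ m : ℕ, ⋂ a : D, ⋂ b : D,
      {f | dist a b < 1 / ((m : ℝ) + 1) → dist (f a) (f b) < 1 / ((n : ℝ) + 1)} := by
    ext f
    simp only [Set.mem_ofPred_eq, Set.mem_iInter, Set.mem_iUnion, Metric.uniformContinuous_iff]
    constructor
    · intro h n
      obtain ⟨δ, hδ, H⟩ := h (1 / ((n : ℝ) + 1)) (by positivity)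
      obtain ⟨m, hm⟩ := exists_nat_one_div_lt hδ
      exact ⟨m, fun a b hab ↦ H (hab.trans hm)⟩
    · intro h ε hε
      obtain ⟨n, hn⟩ := exists_nat_one_div_lt hε
      obtain ⟨m, hm⟩ := h n
      exact ⟨_, by positivity, fun a b hab ↦ (hm a b hab).trans hn⟩
  rw [h]
  refine .iInter fun n ↦ .iUnion fun m ↦ .iInter fun a ↦ .iInter fun b ↦ ?_
  exact .imp (.const _)
    (measurableSet_lt ((measurable_pi_apply a).dist (measurable_pi_apply b)) measurable_const)

variable {D : Set (I × I)}

/-- Restriction to a countable dense set embeds `C([0,1]²)` measurably into a countable power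
of `ℝ`. -/
lemma measurableEmbedding_restrict_continuousMap (hD : Dense D) (hc : D.Countable) :
    MeasurableEmbedding fun (f : C(I × I, ℝ)) (d : D) ↦ f d := by
  have := hc.to_subtype
  -- Lusin–Souslin: a continuous injection on a Polish space is a measurable embedding.
  refine Continuous.measurableEmbedding (by fun_prop) fun f g hfg ↦ ?_
  refine ContinuousMap.coe_injective (Continuous.ext_on hD f.continuous g.continuous ?_)
  exact fun d hd ↦ congrFun hfg ⟨d, hd⟩

variable {Ω Ω' : Type*} [MeasurableSpace Ω] [MeasurableSpace Ω'] {P : Measure Ω}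
  {P' : Measure Ω'}

/-- Two almost surely continuous fields on the unit square with the same joint law on a countable
dense set have identically distributed sample paths. -/
lemma identDistrib_samplePath {Y : I × I → Ω → ℝ} {Z : I × I → Ω' → ℝ} (hD : Dense D)
    (hc : D.Countable) (hY : ∀ p, AEMeasurable (Y p) P) (hZ : ∀ p, AEMeasurable (Z p) P')
    (cY : ∀ᵐ ω ∂P, Continuous fun p ↦ Y p ω) (cZ : ∀ᵐ ω ∂P', Continuous fun p ↦ Z p ω)
    (h : P.map (fun ω (d : D) ↦ Y d ω) = P'.map (fun ω (d : D) ↦ Z d ω)) :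
    IdentDistrib (samplePath Y) (samplePath Z) P P' := by
  have := hc.to_subtype
  have he := measurableEmbedding_restrict_continuousMap hD hc
  set r := fun (f : C(I × I, ℝ)) (d : D) ↦ f d
  have eY : r ∘ samplePath Y =ᵐ[P] fun ω (d : D) ↦ Y d ω := by
    filter_upwards [cY] with ω hω
    ext d
    simp [r, samplePath, hω]
  have eZ : r ∘ samplePath Z =ᵐ[P'] fun ω (d : D) ↦ Z d ω := by
    filter_upwards [cZ] with ω hω
    ext d
    simp [r, samplePath, hω]
  have aY : AEMeasurable (samplePath Y) P :=
    he.aemeasurable_comp_iff.1 ((aemeasurable_pi_lambda _ fun d : D ↦ hY d).congr eY.symm)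
  have aZ : AEMeasurable (samplePath Z) P' :=
    he.aemeasurable_comp_iff.1 ((aemeasurable_pi_lambda _ fun d : D ↦ hZ d).congr eZ.symm)
  refine ⟨aY, aZ, ?_⟩
  rw [← he.comap_map (P.map _), ← he.comap_map (P'.map _),
    AEMeasurable.map_map_of_aemeasurable he.measurable.aemeasurable aY,
    AEMeasurable.map_map_of_aemeasurable he.measurable.aemeasurable aZ,
    Measure.map_congr eY, Measure.map_congr eZ, h]

/-- A function on the unit square which is continuous in the open square, zero on the boundary and
uniformly continuous on a dense grid containing the corners is continuous. -/
lemma continuous_of_uniformContinuous_grid {A : Set I} (hA : Dense A) (h0 : 0 ∈ A) (h1 : 1 ∈ A)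
    {f : I × I → ℝ} (hu : UniformContinuous fun d : A ×ˢ A ↦ f d)
    (hi : ∀ p : I × I, p.1 ∈ Set.Ioo (0 : I) 1 → p.2 ∈ Set.Ioo (0 : I) 1 → ContinuousAt f p)
    (hb : ∀ p : I × I, ¬ (p.1 ∈ Set.Ioo (0 : I) 1 ∧ p.2 ∈ Set.Ioo (0 : I) 1) → f p = 0) :
    Continuous f := by
  have hD : Dense (A ×ˢ A) := hA.prod hA
  set F := hD.extend fun d : A ×ˢ A ↦ f d
  have hF : Continuous F := (hD.uniformContinuous_extend hu).continuous
  have hFD (p : I × I) (hp : p ∈ A ×ˢ A) : F p = f p :=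
    hD.extend_eq hu.continuous ⟨p, hp⟩
  suffices f = F from this ▸ hF
  funext p
  by_cases hp : p.1 ∈ Set.Ioo (0 : I) 1 ∧ p.2 ∈ Set.Ioo (0 : I) 1
  · have : (nhdsWithin p (A ×ˢ A : Set (I × I))).NeBot := mem_closure_iff_nhdsWithin_neBot.1 (hD p)
    refine tendsto_nhds_unique (l := nhdsWithin p (A ×ˢ A))
      ((hi p hp.1 hp.2).mono_left nhdsWithin_le_nhds)
      (((hF.tendsto p).mono_left nhdsWithin_le_nhds).congr' ?_)
    filter_upwards [self_mem_nhdsWithin] with q hq using hFD q hq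
  rw [hb p hp]
  -- As `A` contains 0 and 1, the grid is dense in each edge; the extension `F` vanishes there on
  -- the grid, hence on the edge.
  have hl (g : I → I × I) (hg : Continuous g) (hgA : ∀ x ∈ A, g x ∈ A ×ˢ A)
      (hgb : ∀ x, f (g x) = 0) (x : I) : 0 = F (g x) := by
    refine congrFun (Continuous.ext_on (f := fun _ ↦ 0) hA continuous_const (hF.comp hg) ?_) x
    intro y hy
    simp [hFD _ (hgA y hy), hgb]
  obtain ⟨s, t⟩ := p
  have hs : s = 0 ∨ s = 1 ∨ t = 0 ∨ t = 1 := by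
    by_contra! h
    exact hp ⟨⟨unitInterval.pos_iff_ne_zero.2 h.1, unitInterval.lt_one_iff_ne_one.2 h.2.1⟩,
      ⟨unitInterval.pos_iff_ne_zero.2 h.2.2.1, unitInterval.lt_one_iff_ne_one.2 h.2.2.2⟩⟩
  rcases hs with rfl | rfl | rfl | rfl
  · exact hl (fun x ↦ (0, x)) (by fun_prop) (fun x hx ↦ ⟨h0, hx⟩) (fun x ↦ hb _ (by simp)) t
  · exact hl (fun x ↦ (1, x)) (by fun_prop) (fun x hx ↦ ⟨h1, hx⟩) (fun x ↦ hb _ (by simp)) t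
  · exact hl (fun x ↦ (x, 0)) (by fun_prop) (fun x hx ↦ ⟨hx, h0⟩) (fun x ↦ hb _ (by simp)) s
  · exact hl (fun x ↦ (x, 1)) (by fun_prop) (fun x hx ↦ ⟨hx, h1⟩) (fun x ↦ hb _ (by simp)) s

end PathSpace

/-! ### Gaussianity, covariance and continuity of the fields -/

section Fields

variable {Ω : Type*} {W : ℝ≥0 × ℝ≥0 → Ω → ℝ}

lemma continuous_ouFieldOfWiener (α β sig : ℝ) {ω : Ω} (h : Continuous fun p ↦ W p ω) :
    Continuous fun p ↦ ouFieldOfWiener α β sig W p ω := by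
  unfold ouFieldOfWiener
  refine Continuous.mul (by fun_prop) (h.comp (Continuous.prodMk ?_ ?_)) <;>
    exact Continuous.subtype_mk (by fun_prop) _

/-- Because `min x y - (x + y)/2 = -|y - x|/2`. -/
lemma exp_mul_min_exp (x y : ℝ) :
    Real.exp (-(x + y) / 2) * min (Real.exp x) (Real.exp y) = Real.exp (-|y - x| / 2) := by
  rw [← Real.exp_monotone.map_min, ← Real.exp_add]
  congr 1
  rcases le_total x y with h | h
  · rw [min_eq_left h, abs_of_nonneg (sub_nonneg.2 h)]; ring
  · rw [min_eq_right h, abs_of_nonpos (sub_nonpos.2 h)]; ring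

namespace IsWienerField

/-- Multiples of a time-changed Wiener field are Gaussian processes. -/
lemma mul_comp_isGaussianProcess
    [MeasurableSpace Ω] {P : Measure Ω} (hW : IsWienerField W P) {T : Type*} (c : T → ℝ)
    (g : T → ℝ≥0 × ℝ≥0) : IsGaussianProcess (fun t ω ↦ c t * W (g t) ω) P :=
  (hW.isGaussianProcess.comp_right g).smul c

/-- The exponential time change of a Wiener field is a stationary Ornstein–Uhlenbeck field. -/
lemma isStationaryOUField
    [MeasurableSpace Ω] {P : Measure Ω} (hW : IsWienerField W P) :
    IsStationaryOUField (1 / 2) (1 / 2) 1 (ouFieldOfWiener (1 / 2) (1 / 2) 1 W) P where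
  isGaussianProcess := hW.mul_comp_isGaussianProcess _ _
  mean_eq_zero p := by
    unfold ouFieldOfWiener
    rw [integral_const_mul, hW.mean_eq_zero, mul_zero]
  covariance_eq p q := by
    have hs : √((1 / 2 : ℝ) * (1 / 2)) = 1 / 2 := Real.sqrt_mul_self (by norm_num)
    have e : Real.exp (-(1 / 2) * |q.1 - p.1| - 1 / 2 * |q.2 - p.2|) =
        Real.exp (-|q.1 - p.1| / 2) * Real.exp (-|q.2 - p.2| / 2) := by
      rw [← Real.exp_add]; congr 1; ring
    have ep : Real.exp (-(1 / 2) * p.1 - 1 / 2 * p.2) *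
        Real.exp (-(1 / 2) * q.1 - 1 / 2 * q.2) =
        Real.exp (-(p.1 + q.1) / 2) * Real.exp (-(p.2 + q.2) / 2) := by
      rw [← Real.exp_add, ← Real.exp_add]; congr 1; ring
    have h2 (x : ℝ) : 2 * (1 / 2) * x = x := by ring
    unfold ouFieldOfWiener
    rw [covariance_const_mul_left, covariance_const_mul_right, hW.covariance_eq, hs]
    change _ * (_ * (min (Real.exp (2 * (1 / 2) * p.1)) (Real.exp (2 * (1 / 2) * q.1)) *
      min (Real.exp (2 * (1 / 2) * p.2)) (Real.exp (2 * (1 / 2) * q.2)))) = _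
    rw [e, ← exp_mul_min_exp, ← exp_mul_min_exp, h2, h2, h2, h2]
    linear_combination (min (Real.exp p.1) (Real.exp q.1) *
      min (Real.exp p.2) (Real.exp q.2)) * ep
  ae_continuous := by
    filter_upwards [hW.ae_continuous] with ω h using continuous_ouFieldOfWiener _ _ _ h

end IsWienerField

/-- In one variable this is `√(s(1-s)) · √((1-s)/s) = 1 - s`. -/
lemma sqrt_mul_exp_log_odds {s t : ℝ} (hs : s ∈ Set.Ioo (0 : ℝ) 1) (ht : t ∈ Set.Ioo (0 : ℝ) 1) :
    √(s * t * (1 - s) * (1 - t)) *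
      Real.exp (-(1 / 2) * Real.log (s / (1 - s)) - 1 / 2 * Real.log (t / (1 - t))) =
      (1 - s) * (1 - t) := by
  have h1 := sub_pos.2 hs.2
  have h2 := sub_pos.2 ht.2
  have h3 := hs.1
  have h4 := ht.1
  refine (pow_left_inj₀ (by positivity) (by positivity) two_ne_zero).1 ?_
  rw [mul_pow, Real.sq_sqrt (by positivity), ← Real.exp_nat_mul]
  have e : ((2 : ℕ) : ℝ) *
      (-(1 / 2) * Real.log (s / (1 - s)) - 1 / 2 * Real.log (t / (1 - t))) =
      -Real.log (s / (1 - s) * (t / (1 - t))) := by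
    rw [Real.log_mul (by positivity) (by positivity)]; push_cast; ring
  rw [e, Real.exp_neg, Real.exp_log (by positivity)]
  field_simp

open Classical in
/-- The scaled Ornstein–Uhlenbeck field is a multiple of a time-changed Wiener field. -/
lemma scaledField_ouFieldOfWiener_eq (W : ℝ≥0 × ℝ≥0 → Ω → ℝ) :
    scaledField (ouFieldOfWiener (1 / 2) (1 / 2) 1 W) = fun p ω ↦
      (if (p.1 : ℝ) ∈ Set.Ioo (0 : ℝ) 1 ∧ (p.2 : ℝ) ∈ Set.Ioo (0 : ℝ) 1 then
        (1 - (p.1 : ℝ)) * (1 - (p.2 : ℝ)) else 0) *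
      W (Real.toNNReal (p.1 / (1 - p.1)), Real.toNNReal (p.2 / (1 - p.2))) ω := by
  funext p ω
  have hs : √((1 / 2 : ℝ) * (1 / 2)) = 1 / 2 := Real.sqrt_mul_self (by norm_num)
  have hn {x : ℝ} (hx : x ∈ Set.Ioo (0 : ℝ) 1) (h : 0 ≤ Real.exp (2 * (1 / 2) *
      Real.log (x / (1 - x)))) : (⟨_, h⟩ : ℝ≥0) = Real.toNNReal (x / (1 - x)) := by
    have hpos : 0 < x / (1 - x) := div_pos hx.1 (sub_pos.2 hx.2)
    refine NNReal.eq ?_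
    rw [Real.coe_toNNReal _ hpos.le]
    change Real.exp (2 * (1 / 2) * Real.log (x / (1 - x))) = _
    rw [mul_one_div_cancel two_ne_zero, one_mul, Real.exp_log hpos]
  unfold scaledField ouFieldOfWiener
  split_ifs with h
  · simp only [h, and_self, if_true]
    rw [hn h.1, hn h.2, ← sqrt_mul_exp_log_odds h.1 h.2, hs]
    ring
  -- The factor is 0 on the boundary, so the value of `s/(1-s)` at `s = 1` is irrelevant.
  · simp only [h, if_false, zero_mul]

/-- The odds `x/(1-x)` increase with `x`, so both minima are attained at the same point. The right
side is the covariance of the one-parameter Brownian bridge. -/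
lemma one_sub_mul_min_div {x y : ℝ} (hx : x < 1) (hy : y < 1) :
    (1 - x) * (1 - y) * min (x / (1 - x)) (y / (1 - y)) = min x y - x * y := by
  have h1 := sub_pos.2 hx
  have h2 := sub_pos.2 hy
  rcases le_total x y with h | h
  · rw [min_eq_left h, min_eq_left ((div_le_div_iff₀ h1 h2).2 (by linarith))]
    field_simp
  · rw [min_eq_right h, min_eq_right ((div_le_div_iff₀ h2 h1).2 (by linarith))]
    field_simp

lemma min_sub_mul_eq_zero {x y : I} (hx : ¬ (x : ℝ) ∈ Set.Ioo (0 : ℝ) 1) :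
    min (x : ℝ) y - x * y = 0 := by
  have h : (x : ℝ) = 0 ∨ (x : ℝ) = 1 := by
    by_contra! h
    exact hx ⟨lt_of_le_of_ne x.2.1 h.1.symm, lt_of_le_of_ne x.2.2 h.2⟩
  rcases h with h | h
  · simp [h, y.2.1]
  · simp [h, y.2.2]

lemma covariance_scaledField
    [MeasurableSpace Ω] {P : Measure Ω} (hW : IsWienerField W P) (p q : I × I) :
    cov[scaledField (ouFieldOfWiener (1 / 2) (1 / 2) 1 W) p,
      scaledField (ouFieldOfWiener (1 / 2) (1 / 2) 1 W) q; P] =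
    (min (p.1 : ℝ) q.1 - p.1 * q.1) * (min (p.2 : ℝ) q.2 - p.2 * q.2) := by
  classical
  rw [scaledField_ouFieldOfWiener_eq]
  simp only [covariance_const_mul_left, covariance_const_mul_right, hW.covariance_eq]
  by_cases hp : (p.1 : ℝ) ∈ Set.Ioo (0 : ℝ) 1 ∧ (p.2 : ℝ) ∈ Set.Ioo (0 : ℝ) 1
  · by_cases hq : (q.1 : ℝ) ∈ Set.Ioo (0 : ℝ) 1 ∧ (q.2 : ℝ) ∈ Set.Ioo (0 : ℝ) 1
    · have hc {x : ℝ} (hx : x ∈ Set.Ioo (0 : ℝ) 1) : ((x / (1 - x)).toNNReal : ℝ) = x / (1 - x) :=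
        Real.coe_toNNReal _ (div_pos hx.1 (sub_pos.2 hx.2)).le
      rw [if_pos hp, if_pos hq, ← one_sub_mul_min_div hp.1.2 hq.1.2,
        ← one_sub_mul_min_div hp.2.2 hq.2.2]
      simp only [hc hp.1, hc hp.2, hc hq.1, hc hq.2]
      ring
    · rw [if_neg hq]
      rcases not_and_or.1 hq with h | h
      · rw [min_comm (p.1 : ℝ), mul_comm (p.1 : ℝ), min_sub_mul_eq_zero h]; simp
      · rw [min_comm (p.2 : ℝ), mul_comm (p.2 : ℝ), min_sub_mul_eq_zero h]; simp
  · rw [if_neg hp]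
    rcases not_and_or.1 hp with h | h
    · rw [min_sub_mul_eq_zero h]; simp
    · rw [min_sub_mul_eq_zero h]; simp

section Bridge

/-- As a finite linear combination of values of `W`, the bridge gets its Gaussianity, mean and
covariance by linearity. -/
lemma tiedDownBridge_eq_sum (W : ℝ≥0 × ℝ≥0 → Ω → ℝ) :
    tiedDownBridge W = fun p ω ↦ ∑ i : Fin 4,
      ![1, -(p.1 : ℝ), -(p.2 : ℝ), (p.1 : ℝ) * p.2] i *
      W (![(unitInterval.toNNReal p.1, unitInterval.toNNReal p.2),
        (1, unitInterval.toNNReal p.2), (unitInterval.toNNReal p.1, 1), (1, 1)] i) ω := by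
  funext p ω
  simp only [tiedDownBridge, unitInterval.coe_toNNReal, Fin.sum_univ_four, Matrix.cons_val]
  ring

lemma isGaussianProcess_tiedDownBridge
    [MeasurableSpace Ω] {P : Measure Ω} (hW : IsWienerField W P) :
    IsGaussianProcess (tiedDownBridge W) P := by
  classical
  rw [tiedDownBridge_eq_sum]
  refine hW.isGaussianProcess.of_isGaussianProcess fun p ↦ ?_
  set g := ![(unitInterval.toNNReal p.1, unitInterval.toNNReal p.2),
        (1, unitInterval.toNNReal p.2), (unitInterval.toNNReal p.1, 1), (1, 1)]
  set c := ![1, -(p.1 : ℝ), -(p.2 : ℝ), (p.1 : ℝ) * p.2]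
  -- The four points may coincide, hence the image of `g` as index set.
  refine ⟨Finset.univ.image g, ∑ i, c i • ContinuousLinearMap.proj (R := ℝ)
    (φ := fun _ : Finset.univ.image g ↦ ℝ) ⟨g i, by simp⟩, fun ω ↦ ?_⟩
  simp

lemma integral_tiedDownBridge
    [MeasurableSpace Ω] {P : Measure Ω} (hW : IsWienerField W P) (p : I × I) :
    ∫ ω, tiedDownBridge W p ω ∂P = 0 := by
  rw [tiedDownBridge_eq_sum]
  rw [integral_finsetSum _ fun i _ ↦
    (hW.isGaussianProcess.hasGaussianLaw_eval _).integrable.const_mul _]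
  simp_rw [integral_const_mul, hW.mean_eq_zero, mul_zero, Finset.sum_const_zero]

lemma covariance_tiedDownBridge
    [MeasurableSpace Ω] {P : Measure Ω} (hW : IsWienerField W P) (p q : I × I) :
    cov[tiedDownBridge W p, tiedDownBridge W q; P] =
    (min (p.1 : ℝ) q.1 - p.1 * q.1) * (min (p.2 : ℝ) q.2 - p.2 * q.2) := by
  have := hW.isGaussianProcess.isProbabilityMeasure
  rw [tiedDownBridge_eq_sum]
  rw [covariance_fun_sum_fun_sum
    (fun i ↦ (hW.isGaussianProcess.hasGaussianLaw_eval _).memLp_two.const_mul _)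
    (fun i ↦ (hW.isGaussianProcess.hasGaussianLaw_eval _).memLp_two.const_mul _)]
  simp_rw [covariance_const_mul_left, covariance_const_mul_right, hW.covariance_eq]
  have h1 (x : I) : min 1 (x : ℝ) = x := min_eq_right x.2.2
  have h2 (x : I) : min (x : ℝ) 1 = x := min_eq_left x.2.2
  simp only [Fin.sum_univ_four, Matrix.cons_val, unitInterval.coe_toNNReal,
    NNReal.coe_one, h1, h2, min_self]
  ring

lemma continuous_tiedDownBridge {ω : Ω} (h : Continuous fun p ↦ W p ω) :
    Continuous fun p ↦ tiedDownBridge W p ω := by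
  rw [tiedDownBridge_eq_sum]
  have hn := unitInterval.toNNReal_continuous
  refine continuous_finsetSum _ fun i _ ↦ ?_
  fin_cases i <;>
  · simp only [Fin.mk_zero, Fin.reduceFinMk, Matrix.cons_val, Fin.mk_one]
    exact Continuous.mul (by fun_prop) (h.comp (by fun_prop))

end Bridge

lemma continuousAt_scaledField {X : ℝ × ℝ → Ω → ℝ} {ω : Ω} (h : Continuous fun p ↦ X p ω)
    {p : I × I} (h1 : p.1 ∈ Set.Ioo (0 : I) 1) (h2 : p.2 ∈ Set.Ioo (0 : I) 1) :
    ContinuousAt (fun p ↦ scaledField X p ω) p := by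
  have hlog {g : I × I → I} (hg : Continuous g) (hp : g p ∈ Set.Ioo (0 : I) 1) :
      ContinuousAt (fun q ↦ Real.log ((g q : ℝ) / (1 - g q))) p := by
    have h0 : (0 : ℝ) < g p := hp.1
    have h1 : (g p : ℝ) < 1 := hp.2
    have h3 : (1 - (g p : ℝ)) ≠ 0 := (sub_pos.2 h1).ne'
    refine ContinuousAt.log (ContinuousAt.div ?_ ?_ h3) (div_ne_zero h0.ne' h3)
    · exact (continuous_subtype_val.comp hg).continuousAt
    · exact (continuous_const.sub (continuous_subtype_val.comp hg)).continuousAt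
  have hc : ContinuousAt (fun q : I × I ↦
      √((q.1 : ℝ) * q.2 * (1 - q.1) * (1 - q.2)) *
        X (Real.log (q.1 / (1 - q.1)), Real.log (q.2 / (1 - q.2))) ω) p := by
    refine ContinuousAt.mul (by fun_prop) ?_
    exact ContinuousAt.comp (g := fun p ↦ X p ω) h.continuousAt
      ((hlog continuous_fst h1).prodMk (hlog continuous_snd h2))
  refine hc.congr ?_
  have hU : Set.Ioo (0 : I) 1 ×ˢ Set.Ioo (0 : I) 1 ∈ nhds p :=
    (isOpen_Ioo.prod isOpen_Ioo).mem_nhds ⟨h1, h2⟩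
  filter_upwards [hU] with q hq
  exact (if_pos ⟨⟨hq.1.1, hq.1.2⟩, ⟨hq.2.1, hq.2.2⟩⟩).symm

lemma scaledField_eq_zero (X : ℝ × ℝ → Ω → ℝ) (ω : Ω) {p : I × I}
    (hp : ¬ (p.1 ∈ Set.Ioo (0 : I) 1 ∧ p.2 ∈ Set.Ioo (0 : I) 1)) : scaledField X p ω = 0 :=
  if_neg fun h ↦ hp ⟨⟨h.1.1, h.1.2⟩, ⟨h.2.1, h.2.2⟩⟩

end Fields

theorem proposition2 {Ω Ω' : Type*} [MeasurableSpace Ω] [MeasurableSpace Ω']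
    (P : Measure Ω) [IsProbabilityMeasure P] (P' : Measure Ω') [IsProbabilityMeasure P']
    (W : ℝ≥0 × ℝ≥0 → Ω → ℝ) (hW : IsWienerField W P)
    (W' : ℝ≥0 × ℝ≥0 → Ω' → ℝ) (hW' : IsWienerField W' P')
    (X : ℝ × ℝ → Ω → ℝ) (hX : X = ouFieldOfWiener (1 / 2) (1 / 2) 1 W) :
    IsStationaryOUField (1 / 2) (1 / 2) 1 X P ∧
    (∀ᵐ ω ∂P, Continuous fun p ↦ scaledField X p ω) ∧
    (∀ᵐ ω ∂P', Continuous fun p ↦ tiedDownBridge W' p ω) ∧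
    IdentDistrib (samplePath (scaledField X)) (samplePath (tiedDownBridge W')) P P' := by
  subst hX
  set U := scaledField (ouFieldOfWiener (1 / 2) (1 / 2) 1 W) with hU
  have gU : IsGaussianProcess U P := by
    rw [hU, scaledField_ouFieldOfWiener_eq]
    exact hW.mul_comp_isGaussianProcess _ _
  have mU (p) : ∫ ω, U p ω ∂P = 0 := by
    rw [hU, scaledField_ouFieldOfWiener_eq, integral_const_mul, hW.mean_eq_zero, mul_zero]
  have gB := isGaussianProcess_tiedDownBridge hW'
  have cB : ∀ᵐ ω ∂P', Continuous fun p ↦ tiedDownBridge W' p ω := by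
    filter_upwards [hW'.ae_continuous] with ω h using continuous_tiedDownBridge h
  obtain ⟨A₀, hA₀c, hA₀d⟩ := TopologicalSpace.exists_countable_dense I
  set A : Set I := insert 0 (insert 1 A₀)
  have hAd : Dense A :=
    hA₀d.mono ((Set.subset_insert _ _).trans (Set.subset_insert _ _))
  have hAc : (A ×ˢ A).Countable := ((hA₀c.insert 1).insert 0).prod ((hA₀c.insert 1).insert 0)
  have := hAc.to_subtype
  have hlaw : P.map (fun ω (d : A ×ˢ A) ↦ U d ω) =
      P'.map (fun ω (d : A ×ˢ A) ↦ tiedDownBridge W' d ω) :=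
    IsGaussianProcess.map_eq_of_covariance_eq (X := fun d : A ×ˢ A ↦ U d)
      (Y := fun d : A ×ˢ A ↦ tiedDownBridge W' d) (gU.restrict _) (gB.restrict _)
      (fun _ ↦ mU _) (fun _ ↦ integral_tiedDownBridge hW' _) fun p q ↦ by
        rw [hU, covariance_scaledField hW, covariance_tiedDownBridge hW']
  have hms := measurableSet_setOf_uniformContinuous (A ×ˢ A)
  -- The event depends only on the values on the grid, so it passes from the bridge to `U` through
  -- `hlaw`.
  have uU : ∀ᵐ ω ∂P, UniformContinuous fun d : A ×ˢ A ↦ U d ω := by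
    refine (ae_map_iff (aemeasurable_pi_lambda _ fun d : A ×ˢ A ↦ gU.aemeasurable d) hms).1 ?_
    rw [hlaw]
    refine (ae_map_iff (aemeasurable_pi_lambda _ fun d : A ×ˢ A ↦ gB.aemeasurable d) hms).2 ?_
    filter_upwards [cB] with ω h using
      (CompactSpace.uniformContinuous_of_continuous h).comp uniformContinuous_subtype_val
  have cU : ∀ᵐ ω ∂P, Continuous fun p ↦ U p ω := by
    filter_upwards [uU, hW.isStationaryOUField.ae_continuous] with ω hu hc
    exact continuous_of_uniformContinuous_grid hAd (by simp [A]) (by simp [A]) hu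
      (fun p h1 h2 ↦ continuousAt_scaledField hc h1 h2) fun p hp ↦ scaledField_eq_zero _ _ hp
  exact ⟨hW.isStationaryOUField, cU, cB,
    identDistrib_samplePath (hAd.prod hAd) hAc gU.aemeasurable gB.aemeasurable cU cB hlaw⟩
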